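/- Let $k$ be an algebraically closed field of characteristic zero; all algebras are unital and associative over $k$. For an algebra $S$ let $\mathrm{mid}(S)\in\mathbb N\cup\{\infty\}$ be the supremum of the $k$-dimensions of the irreducible representations (simple modules) of $S$. Let $l\ge 1$, $A=k^{\oplus l}$ with its primitive idempotents $p_1,\dots,p_l$, $B=k^{\oplus 2}$ with its primitive idempotents $q_1,q_2$, and let $R=A*B$ be the free product of algebras. Put $\overline A=\langle p_1,\dots,p_{l-1}\rangle_k$ and $\overline B=\langle q_1\rangle_k$, and let $V\subseteq\overline A\oplus\overline B\subset R$ be a linear subspace. Let $(V,R)^{ab}$ be the quotient of $R$ by the two-sided ideal generated by all commutators $[x,y]$ with $x,y\in R(V)$, where $R(V)\subseteq R$ is the subalgebra generated by $V$. Let $A(V)\subseteq A$ be the subalgebra generated by $V\cap\overline A$, and let $\{1,\dots,l\}=\bigsqcup_j I_j$ be the partition in which $i$ and $i'$ lie in the same block if and only if $x_i=x_{i'}$ for all $x=\sum_i x_ip_i\in V\cap\overline A$ (so that $A(V)$ has the basis $P_j=\sum_{i\in I_j}p_i$). Then: - If $V\subseteq\overline A$, then $(V,R)^{ab}=R$,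 i.e. the quotient map $R\to (V,R)^{ab}$ is bijective. - If $V\nsubseteq\overline A$ and $A(V)=A$, then $(V,R)^{ab}\cong A\otimes_k B$ as algebras, by an isomorphism that sends the class of $a\in A$ to $a\otimes 1$ and the class of $b\in B$ to $1\otimes b$; hence $\mathrm{mid}((V,R)^{ab})=1$. - If $V\nsubseteq\overline A$ and $\max_j|I_j|=2$, then $\mathrm{mid}((V,R)^{ab})=2$. - If $V\nsubseteq\overline A$ and $\max_j|I_j|>2$, then $\mathrm{mid}((V,R)^{ab})=\infty$; more precisely, $(V,R)^{ab}$ has irreducible representations of arbitrarily large finite dimension. -/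

import Mathlib

universe u

noncomputable section

namespace PartialAbelianization

/-! ### The free product `A * B` of two unital associative algebras -/

/-- The two-member family `(A, B)`. -/
def AlgPair (A B : Type u) : Bool → Type u
  | false => A
  | true => B

instance instRingAlgPair (A B : Type u) [Ring A] [Ring B] : ∀ i, Ring (AlgPair A B i)
  | false => inferInstanceAs (Ring A)
  | true => inferInstanceAs (Ring B)

instance instAlgebraAlgPair (k : Type u) [Field k] (A B : Type u) [Ring A] [Ring B]
    [Algebra k A] [Algebra k B] : ∀ i, Algebra k (AlgPair A B i)
  | false => inferInstanceAs (Algebra k A)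
  | true => inferInstanceAs (Algebra k B)

/-- The free product (coproduct of unital associative `k`-algebras) `A * B`. -/
abbrev FreeProd (k : Type u) [Field k] (A B : Type u) [Ring A] [Ring B]
    [Algebra k A] [Algebra k B] : Type u :=
  LinearAlgebra.FreeProduct k (AlgPair A B)

/-- The canonical map `A → A * B`. -/
def FreeProd.inl (k : Type u) [Field k] (A B : Type u) [Ring A] [Ring B]
    [Algebra k A] [Algebra k B] : A →ₐ[k] FreeProd k A B :=
  LinearAlgebra.FreeProduct.ι k (AlgPair A B) false

/-- The canonical map `B → A * B`. -/
def FreeProd.inr (k : Type u) [Field k] (A B : Type u) [Ring A] [Ring B]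
    [Algebra k A] [Algebra k B] : B →ₐ[k] FreeProd k A B :=
  LinearAlgebra.FreeProduct.ι k (AlgPair A B) true

/-! ### Partial abelianization -/

section General

variable {k : Type u} [Field k] {R : Type u} [Ring R] [Algebra k R]

/-- The two-sided ideal of `R` generated by the commutators `[R₁, R₁]`. -/
def commutatorIdeal (R₁ : Subalgebra k R) : TwoSidedIdeal R :=
  TwoSidedIdeal.span {x | ∃ a ∈ R₁, ∃ b ∈ R₁, x = a * b - b * a}

/-- The partial abelianization `(R₁, R)^{ab}`: the quotient of `R` by the two-sided ideal
generated by `[R₁, R₁]`. -/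
abbrev PartialAb (R₁ : Subalgebra k R) : Type u :=
  (commutatorIdeal R₁).ringCon.Quotient

/-- The quotient map `R → (R₁, R)^{ab}`. -/
def PartialAb.mk (R₁ : Subalgebra k R) : R →ₐ[k] PartialAb R₁ :=
  RingCon.mkₐ k (commutatorIdeal R₁).ringCon

/-- `(V, R)^{ab}` for a subspace `V` of `R`: the partial abelianization of `R` with respect to
the subalgebra `R(V)` generated by `V`. -/
abbrev SubspaceAb (V : Submodule k R) : Type u :=
  PartialAb (Algebra.adjoin k (V : Set R))

/-- The quotient map `R → (V, R)^{ab}`. -/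
abbrev SubspaceAb.mk (V : Submodule k R) : R →ₐ[k] SubspaceAb V :=
  PartialAb.mk (Algebra.adjoin k (V : Set R))

end General

/-! ### Dimensions of irreducible representations -/

section Mid

variable (k : Type u) [Field k] (S : Type u) [Ring S] [Algebra k S]

/-- The set of the dimensions over `k` (possibly `∞`) of the irreducible representations of the
`k`-algebra `S`, that is of its simple modules. (Every simple module is a quotient of `S`, so
modules in the universe of `S` suffice.) -/
def irrepDims : Set ℕ∞ :=
  {d | ∃ (M : Type u) (_ : AddCommGroup M) (_ : Module k M) (_ : Module S M)
    (_ : IsScalarTower k S M), IsSimpleModule S M ∧ d = Cardinal.toENat (Module.rank k M)}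

/-- `mid(S)`, the maximal dimension of an irreducible representation of `S`. -/
def mid : ℕ∞ := sSup (irrepDims k S)

end Mid

/-! ### The algebras `k^{⊕ l}` -/

section Diagonal

variable (k : Type u) [Field k] (l : ℕ)

/-- The algebra `k^{⊕ l}`. -/
abbrev Diag : Type u := Fin l → k

/-- The primitive idempotent `p_i` of `k^{⊕ l}`. -/
def idem (i : Fin l) : Diag k l := Pi.single i 1

/-- The complement of `k · 1` in `k^{⊕ l}` spanned by all the primitive idempotents but the
last one. -/
def bar : Submodule k (Diag k l) :=
  Submodule.span k {x | ∃ i : Fin l, (i : ℕ) + 1 < l ∧ x = idem k l i}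

/-- The subspace `W_I` of `k^{⊕ l}` of the vectors whose coordinates with indices in `I` are all
equal. -/
def W (I : Set (Fin l)) : Submodule k (Diag k l) where
  carrier := {x | ∀ i ∈ I, ∀ j ∈ I, x i = x j}
  add_mem' hx hy i hi j hj := by simp [hx i hi j hj, hy i hi j hj]
  zero_mem' _ _ _ _ := rfl
  smul_mem' c x hx i hi j hj := by simp [hx i hi j hj]

variable {k l}

open scoped Classical in
/-- The block of the index `i` with respect to a subspace `V₁` of `k^{⊕ l}`: the indices `j`
such that `x_i = x_j` on `V₁`. The blocks are the members `I_j` of the coarsest partition of the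
set of indices such that `V₁` is contained in every `W_{I_j}`. -/
def block (V₁ : Submodule k (Diag k l)) (i : Fin l) : Finset (Fin l) :=
  Finset.univ.filter fun j => V₁ ≤ W k l {i, j}

/-- The largest size of a block. -/
def maxBlock (V₁ : Submodule k (Diag k l)) : ℕ :=
  Finset.univ.sup fun i => (block V₁ i).card

theorem mem_block {V₁ : Submodule k (Diag k l)} {i j : Fin l} :
    j ∈ block V₁ i ↔ ∀ x ∈ V₁, x i = x j := by
  simp only [block, Finset.mem_filter, Finset.mem_univ, true_and]
  constructor
  · intro h x hx
    exact h hx i (by simp) j (by simp)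
  · rintro h x hx a ha b hb
    have := h x hx
    rcases ha with rfl | rfl <;> rcases hb with rfl | rfl <;> simp_all

/-- The subalgebra generated by `V₁` is spanned by the elements `P_I = ∑_{i ∈ I} p_i`, where `I`
runs through the blocks of `V₁`. -/
theorem adjoin_eq_span_block (V₁ : Submodule k (Diag k l)) :
    Subalgebra.toSubmodule (Algebra.adjoin k (V₁ : Set (Diag k l))) =
      Submodule.span k (Set.range fun i => ∑ j ∈ block V₁ i, idem k l j) := by
  classical
  have hP : ∀ i m, (∑ j ∈ block V₁ i, idem k l j) m = if m ∈ block V₁ i then 1 else 0 := by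
    intro i m
    simp [idem, Finset.sum_apply, Pi.single_apply]
  have hsymm : ∀ i j, j ∈ block V₁ i → block V₁ j = block V₁ i := by
    intro i j h
    rw [mem_block] at h
    ext m
    rw [mem_block, mem_block]
    exact ⟨fun H x hx => (h x hx).trans (H x hx), fun H x hx => (h x hx).symm.trans (H x hx)⟩
  have hself : ∀ i, i ∈ block V₁ i := fun i => mem_block.2 fun _ _ => rfl
  apply le_antisymm
  · intro x hx
    have hconst : ∀ i j, j ∈ block V₁ i → x i = x j := by
      intro i j hij
      rw [mem_block] at hij
      induction (hx : x ∈ Algebra.adjoin k (V₁ : Set (Diag k l))) using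
        Algebra.adjoin_induction with
      | mem y hy => exact hij y hy
      | algebraMap r => simp
      | add a b _ _ ha hb => simp [ha, hb]
      | mul a b _ _ ha hb => simp [ha, hb]
    have : x = ∑ B ∈ Finset.univ.image (block V₁),
        ∑ j ∈ B, x j • idem k l j := by
      rw [Finset.sum_image' (fun m => x m • idem k l m)]
      · ext m
        simp [idem, Finset.sum_apply, Pi.single_apply]
      · intro i _
        refine Finset.sum_congr ?_ fun _ _ => rfl
        ext j
        simp only [Finset.mem_filter, Finset.mem_univ, true_and]
        exact ⟨hsymm i j, fun h => h ▸ hself j⟩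
    rw [this]
    refine Submodule.sum_mem _ fun B hB => ?_
    obtain ⟨i, -, rfl⟩ := Finset.mem_image.1 hB
    have : ∑ j ∈ block V₁ i, x j • idem k l j = x i • ∑ j ∈ block V₁ i, idem k l j := by
      rw [Finset.smul_sum]
      exact Finset.sum_congr rfl fun j hj => by rw [hconst i j hj]
    rw [this]
    exact Submodule.smul_mem _ _ (Submodule.subset_span ⟨i, rfl⟩)
  · rw [Submodule.span_le]
    rintro _ ⟨i, rfl⟩
    have hsep : ∀ j, ∃ f ∈ Algebra.adjoin k (V₁ : Set (Diag k l)),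
        (∀ m ∈ block V₁ i, f m = 1) ∧ (j ∉ block V₁ i → f j = 0) := by
      intro j
      by_cases hj : j ∈ block V₁ i
      · exact ⟨1, one_mem _, fun _ _ => rfl, fun h => absurd hj h⟩
      · have hj' := hj
        rw [mem_block] at hj
        push Not at hj
        obtain ⟨x, hx, hne⟩ := hj
        refine ⟨(x i - x j)⁻¹ • (x - algebraMap k _ (x j)), ?_, ?_, ?_⟩
        · exact Subalgebra.smul_mem _
            (sub_mem (Algebra.subset_adjoin hx) (Subalgebra.algebraMap_mem _ _)) _
        · intro m hm
          have := mem_block.1 hm x hx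
          simp [← this, inv_mul_cancel₀ (sub_ne_zero.2 hne)]
        · intro _
          simp
    choose f hf h1 h0 using hsep
    have : ∑ j ∈ block V₁ i, idem k l j = ∏ j, f j := by
      ext m
      rw [hP, Finset.prod_apply]
      split_ifs with hm
      · exact (Finset.prod_eq_one fun j _ => h1 j m hm).symm
      · exact (Finset.prod_eq_zero (f := fun j => f j m) (Finset.mem_univ m) (h0 m hm)).symm
    change _ ∈ Algebra.adjoin k (V₁ : Set (Diag k l))
    simp only [this]
    exact prod_mem fun j _ => hf j

end Diagonal

/-! ### Subspaces of `k^{⊕ l} * k^{⊕ 2}` -/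

section Main

variable (k : Type u) [Field k] (l : ℕ)

/-- The algebra `R = A * B` with `A = k^{⊕ l}` and `B = k^{⊕ 2}`. -/
abbrev RAlg : Type u := FreeProd k (Diag k l) (Diag k 2)

/-- The inclusion `A → R`. -/
abbrev inA : Diag k l →ₐ[k] RAlg k l := FreeProd.inl k (Diag k l) (Diag k 2)

/-- The inclusion `B → R`. -/
abbrev inB : Diag k 2 →ₐ[k] RAlg k l := FreeProd.inr k (Diag k l) (Diag k 2)

/-- `Ā` as a subspace of `R`. -/
def Abar : Submodule k (RAlg k l) := (bar k l).map (inA k l).toLinearMap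

/-- `B̄` as a subspace of `R`. -/
def Bbar : Submodule k (RAlg k l) := (bar k 2).map (inB k l).toLinearMap

variable {k l}

/-- `V₁ = V ∩ Ā`, as a subspace of `A`. -/
def interA (V : Submodule k (RAlg k l)) : Submodule k (Diag k l) :=
  bar k l ⊓ V.comap (inA k l).toLinearMap

/-- `A(V)`, the subalgebra of `A` generated by `V ∩ Ā`. -/
def AOf (V : Submodule k (RAlg k l)) : Subalgebra k (Diag k l) :=
  Algebra.adjoin k (interA V : Set (Diag k l))

end Main

end PartialAbelianization

end

/-! Suppose `V` is not contained in `Ā`. Then `V` is spanned by `V ∩ Ā` and one vector `a + q₁`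
(`exists_complement`). Since `A` is commutative, the relations of `(V, R)^{ab}` say exactly that `V
∩ Ā`, hence `A(V)`, commutes with `q₁`. So simple modules correspond to irreducible pairs: a
representation `α` of `A` and an idempotent `e` that commutes with `α(A(V))`
(`IsIrreduciblePair.mem_irrepDims`, `exists_isIrreduciblePair`).

The block idempotents `P_j` commute with both `α(A)` and `e`, so exactly one of them acts as `1` and
the others as `0` (`IsIrreduciblePair.exists_block`). Conversely, if `α` is supported on one block,
`V ∩ Ā` acts by scalars and `e` is free (`commute_pullbackRep`). Everything thus depends on block
sizes. A block of size 1 gives scalars and one idempotent, so dimension 1. A block of size 2 gives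
two idempotents `p`, `e`; the central element `(p - e)²` forces dimension at most 2
(`IsIrreduciblePair.rank_le_two`), and averaging on two points attains it. Three indices in a block
already allow irreducible pairs of dimension `3(n + 1)` for every `n` (`isIrreduciblePair_cyclic`).
-/

noncomputable section

namespace PartialAbelianization

/-! ### Universal properties of the free product and of the partial abelianization -/

section UniversalProperties

variable {k : Type u} [Field k] {A B : Type u} [Ring A] [Ring B] [Algebra k A] [Algebra k B]
  {T : Type*} [Semiring T] [Algebra k T]

/-- The algebra homomorphism `A * B → T` given by two algebra homomorphisms. -/
def FreeProd.lift (f : A →ₐ[k] T) (g : B →ₐ[k] T) : FreeProd k A B →ₐ[k] T :=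
  LinearAlgebra.FreeProduct.lift k (AlgPair A B) fun {i} =>
    match i with
    | false => f
    | true => g

@[simp]
theorem FreeProd.lift_inl (f : A →ₐ[k] T) (g : B →ₐ[k] T) (a : A) :
    FreeProd.lift f g (FreeProd.inl k A B a) = f a :=
  DFunLike.congr_fun (LinearAlgebra.FreeProduct.lift_comp_ι (i := false) k (AlgPair A B)
    (fun {i} => match i with
    | false => f
    | true => g)) a

@[simp]
theorem FreeProd.lift_inr (f : A →ₐ[k] T) (g : B →ₐ[k] T) (b : B) :
    FreeProd.lift f g (FreeProd.inr k A B b) = g b :=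
  DFunLike.congr_fun (LinearAlgebra.FreeProduct.lift_comp_ι (i := true) k (AlgPair A B)
    (fun {i} => match i with
    | false => f
    | true => g)) b

theorem FreeProd.hom_ext {f g : FreeProd k A B →ₐ[k] T}
    (hA : ∀ a, f (FreeProd.inl k A B a) = g (FreeProd.inl k A B a))
    (hB : ∀ b, f (FreeProd.inr k A B b) = g (FreeProd.inr k A B b)) : f = g := by
  apply (LinearAlgebra.FreeProduct.lift k (AlgPair A B)).symm.injective
  funext i
  cases i
  · exact AlgHom.ext hA
  · exact AlgHom.ext hB

/-- A subalgebra of `A * B` that contains `A` and `B` is everything. -/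
theorem FreeProd.eq_top_of_mem (S : Subalgebra k (FreeProd k A B))
    (hA : ∀ a, FreeProd.inl k A B a ∈ S) (hB : ∀ b, FreeProd.inr k A B b ∈ S) : S = ⊤ := by
  have h : S.val.comp (FreeProd.lift ((FreeProd.inl k A B).codRestrict S hA)
      ((FreeProd.inr k A B).codRestrict S hB)) = AlgHom.id k _ :=
    FreeProd.hom_ext (fun a => by simp) (fun b => by simp)
  refine Algebra.eq_top_iff.2 fun x => ?_
  have := DFunLike.congr_fun h x
  rw [AlgHom.id_apply] at this
  rw [← this]
  exact Subtype.property _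

variable {R : Type u} [Ring R] [Algebra k R]

theorem PartialAb.mk_surjective (R₁ : Subalgebra k R) : Function.Surjective (PartialAb.mk R₁) :=
  RingCon.mkₐ_surjective _

theorem PartialAb.commute_mk {R₁ : Subalgebra k R} {x y : R} (hx : x ∈ R₁) (hy : y ∈ R₁) :
    Commute (PartialAb.mk R₁ x) (PartialAb.mk R₁ y) := by
  change _ * _ = _ * _
  rw [← map_mul, ← map_mul]
  exact Quotient.sound' ((TwoSidedIdeal.rel_iff _ _ _).2
    (TwoSidedIdeal.subset_span ⟨x, hx, y, hy, rfl⟩))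

/-- Commutation on `V` spreads to the generated subalgebra one argument at a time, because
centralizers are subalgebras; hence `f` kills the commutator ideal. -/
theorem SubspaceAb.exists_lift {T : Type*} [Ring T] [Algebra k T] (V : Submodule k R)
    (f : R →ₐ[k] T) (hf : ∀ x ∈ V, ∀ y ∈ V, Commute (f x) (f y)) :
    ∃ F : SubspaceAb V →ₐ[k] T, ∀ x, F (SubspaceAb.mk V x) = f x := by
  have hadj : ∀ x ∈ Algebra.adjoin k (V : Set R), ∀ y ∈ Algebra.adjoin k (V : Set R),
      Commute (f x) (f y) := by
    intro x hx y hy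
    have hx' : f x ∈ Algebra.adjoin k (f '' (V : Set R)) := by
      rw [← AlgHom.map_adjoin]; exact ⟨x, hx, rfl⟩
    have hy' : f y ∈ Algebra.adjoin k (f '' (V : Set R)) := by
      rw [← AlgHom.map_adjoin]; exact ⟨y, hy, rfl⟩
    refine Algebra.commute_of_mem_adjoin_of_forall_mem_commute hy' ?_
    rintro _ ⟨v, hv, rfl⟩
    refine (Algebra.commute_of_mem_adjoin_of_forall_mem_commute hx' ?_).symm
    rintro _ ⟨w, hw, rfl⟩
    exact hf v hv w hw
  have hle : commutatorIdeal (Algebra.adjoin k (V : Set R)) ≤ TwoSidedIdeal.ker f := by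
    refine TwoSidedIdeal.span_le.2 ?_
    rintro _ ⟨x, hx, y, hy, rfl⟩
    rw [SetLike.mem_coe, TwoSidedIdeal.mem_ker, map_sub, map_mul, map_mul, sub_eq_zero]
    exact hadj x hx y hy
  refine ⟨RingCon.liftₐ _ f ?_, fun x => rfl⟩
  intro x y hxy
  exact TwoSidedIdeal.ringCon_le_iff.1 hle hxy

end UniversalProperties

/-! ### The relations of the partial abelianization in terms of `V ∩ Ā` and `q₁` -/

section Structure

variable {k : Type u} [Field k] {l : ℕ}

theorem exists_of_mem_Bbar {b : RAlg k l} (hb : b ∈ Bbar k l) :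
    ∃ c : k, b = c • inB k l (idem k 2 0) := by
  obtain ⟨b, hb, rfl⟩ := hb
  have hbar : bar k 2 ≤ Submodule.span k {idem k 2 0} := by
    refine Submodule.span_mono ?_
    rintro _ ⟨i, hi, rfl⟩
    obtain rfl : i = 0 := by ext; simp; omega
    rfl
  obtain ⟨c, rfl⟩ := Submodule.mem_span_singleton.1 (hbar hb)
  exact ⟨c, by simp⟩

variable {V : Submodule k (RAlg k l)}

theorem mem_of_mem_interA {x : Diag k l} (hx : x ∈ interA V) : inA k l x ∈ V := hx.2

/-- A subspace of `Ā ⊕ B̄` that is not contained in `Ā` is spanned by its intersection with `Ā`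
and one vector `a + q₁`. -/
theorem exists_complement (hV : V ≤ Abar k l ⊔ Bbar k l) (hVA : ¬ V ≤ Abar k l) :
    ∃ a : Diag k l, inA k l a + inB k l (idem k 2 0) ∈ V ∧
      ∀ v ∈ V, ∃ x ∈ interA V, ∃ c : k,
        v = inA k l x + c • (inA k l a + inB k l (idem k 2 0)) := by
  have hdec : ∀ v ∈ V, ∃ x ∈ bar k l, ∃ c : k, v = inA k l x + c • inB k l (idem k 2 0) := by
    intro v hv
    obtain ⟨_, ⟨x, hx, rfl⟩, b, hb, rfl⟩ := Submodule.mem_sup.1 (hV hv)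
    obtain ⟨c, rfl⟩ := exists_of_mem_Bbar hb
    exact ⟨x, hx, c, rfl⟩
  obtain ⟨v, hv, hvA⟩ := SetLike.not_le_iff_exists.1 hVA
  obtain ⟨x, hx, c, rfl⟩ := hdec v hv
  have hc : c ≠ 0 := by
    rintro rfl
    exact hvA ⟨x, hx, by simp⟩
  have ha : inA k l (c⁻¹ • x) + inB k l (idem k 2 0) ∈ V := by
    have := V.smul_mem c⁻¹ hv
    rwa [smul_add, smul_smul, inv_mul_cancel₀ hc, one_smul, ← map_smul] at this
  refine ⟨c⁻¹ • x, ha, fun w hw => ?_⟩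
  obtain ⟨y, hy, d, rfl⟩ := hdec w hw
  -- Subtracting `d` times the normalized vector cancels the `q₁`-component, which leaves an element
  -- of `V ∩ Ā`.
  have hdiff : inA k l y + d • inB k l (idem k 2 0)
      - d • (inA k l (c⁻¹ • x) + inB k l (idem k 2 0)) = inA k l (y - d • c⁻¹ • x) := by
    simp only [map_sub, map_smul, smul_add]
    abel
  refine ⟨y - d • c⁻¹ • x, ⟨sub_mem hy (Submodule.smul_mem _ _ (Submodule.smul_mem _ _ hx)), ?_⟩,
    d, ?_⟩
  · change inA k l _ ∈ V
    rw [← hdiff]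
    exact sub_mem hw (V.smul_mem d ha)
  · rw [← hdiff]
    abel

/-- In `(V, R)^{ab}` the elements of `V ∩ Ā` commute with `q₁`. -/
theorem commute_mk_of_mem_interA (hV : V ≤ Abar k l ⊔ Bbar k l) (hVA : ¬ V ≤ Abar k l)
    {x : Diag k l} (hx : x ∈ interA V) :
    Commute (SubspaceAb.mk V (inA k l x)) (SubspaceAb.mk V (inB k l (idem k 2 0))) := by
  obtain ⟨a, ha, -⟩ := exists_complement hV hVA
  have h := PartialAb.commute_mk (Algebra.subset_adjoin (R := k) (mem_of_mem_interA hx))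
    (Algebra.subset_adjoin (R := k) ha)
  have h' : Commute (SubspaceAb.mk V (inA k l x)) (SubspaceAb.mk V (inA k l a)) :=
    ((Commute.all x a).map (inA k l)).map (SubspaceAb.mk V)
  have := h.sub_right h'
  -- `x` commutes with `a + q₁` and with `a`, hence with the difference `q₁`.
  rwa [← map_sub, add_sub_cancel_left] at this

/-- Converse of `commute_mk_of_mem_interA`: `a + q₁` commutes with itself and `A` is commutative, so
the only relations to check are those between `V ∩ Ā` and `q₁`. -/
theorem commute_map_of_commute_interA {T : Type*} [Ring T] [Algebra k T]
    (hV : V ≤ Abar k l ⊔ Bbar k l) (hVA : ¬ V ≤ Abar k l) (f : RAlg k l →ₐ[k] T)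
    (hf : ∀ x ∈ interA V, Commute (f (inA k l x)) (f (inB k l (idem k 2 0)))) :
    ∀ x ∈ V, ∀ y ∈ V, Commute (f x) (f y) := by
  obtain ⟨a, -, hdec⟩ := exists_complement hV hVA
  have hA : ∀ x y, Commute (f (inA k l x)) (f (inA k l y)) :=
    fun x y => ((Commute.all x y).map (inA k l)).map f
  intro v hv w hw
  obtain ⟨x, hx, c, rfl⟩ := hdec v hv
  obtain ⟨y, hy, d, rfl⟩ := hdec w hw
  have h1 : ∀ z ∈ interA V, Commute (f (inA k l z))
      (f (inA k l a + inB k l (idem k 2 0))) := by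
    intro z hz
    rw [map_add]
    exact (hA z a).add_right (hf z hz)
  simp only [map_add f (inA k l x), map_add f (inA k l y), map_smul]
  exact ((hA x y).add_right ((h1 x hx).smul_right d)).add_left
    (((h1 y hy).symm.add_right ((Commute.refl _).smul_right d)).smul_left c)

/-- An element of `A(V)` acts by elements that commute with `q₁`. -/
theorem commute_of_mem_AOf {T : Type*} [Ring T] [Algebra k T] (α : Diag k l →ₐ[k] T) {e : T}
    (h : ∀ x ∈ interA V, Commute (α x) e) {x : Diag k l} (hx : x ∈ AOf V) :
    Commute (α x) e := by
  refine (Algebra.commute_of_mem_adjoin_of_forall_mem_commute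
    (s := α '' (interA V : Set (Diag k l))) (R := k) ?_ ?_).symm
  · rw [← AlgHom.map_adjoin]; exact ⟨x, hx, rfl⟩
  · rintro _ ⟨y, hy, rfl⟩
    exact (h y hy).symm

theorem block_idem_mem_AOf (i : Fin l) : ∑ j ∈ block (interA V) i, idem k l j ∈ AOf V := by
  have := adjoin_eq_span_block (interA V)
  change _ ∈ Subalgebra.toSubmodule (AOf V)
  rw [AOf, this]
  exact Submodule.subset_span ⟨i, rfl⟩

end Structure

/-! ### Simple modules as irreducible pairs -/

section IrreduciblePairs

variable {k : Type u} [Field k] {l : ℕ} {M : Type*} [AddCommGroup M] [Module k M]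

/-- A representation `α` of `k^{⊕ l}` and an idempotent endomorphism `e` of the same nonzero space
without a common proper nonzero invariant subspace. -/
structure IsIrreduciblePair (α : Diag k l →ₐ[k] Module.End k M) (e : Module.End k M) : Prop where
  nontrivial : Nontrivial M
  idempotent : e * e = e
  eq_bot_or_eq_top : ∀ U : Submodule k M, (∀ a, ∀ u ∈ U, α a u ∈ U) → (∀ u ∈ U, e u ∈ U) →
    U = ⊥ ∨ U = ⊤

/-- The representation of `k^{⊕ 2}` in which the first primitive idempotent acts by `e`. -/
def homOfIdempotent {T : Type*} [Ring T] [Algebra k T] (e : T) (he : e * e = e) :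
    Diag k 2 →ₐ[k] T :=
  AlgHom.ofLinearMap
    ((LinearMap.proj 0).smulRight e + (LinearMap.proj 1).smulRight (1 - e))
    (by simp)
    (by
      intro x y
      simp only [LinearMap.add_apply, LinearMap.smulRight_apply, LinearMap.proj_apply,
        Pi.mul_apply]
      simp only [add_mul, mul_add, smul_mul_smul_comm, he, mul_sub, sub_mul, mul_one, one_mul,
        sub_self, smul_zero, sub_zero, add_zero, zero_add])

theorem homOfIdempotent_apply {T : Type*} [Ring T] [Algebra k T] (e : T) (he : e * e = e)
    (b : Diag k 2) : homOfIdempotent e he b = b 0 • e + b 1 • (1 - e) := rfl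

theorem homOfIdempotent_idem {T : Type*} [Ring T] [Algebra k T] (e : T) (he : e * e = e) :
    homOfIdempotent e he (idem k 2 0) = e := by
  simp [homOfIdempotent_apply, idem]

theorem diag_two_eq (b : Diag k 2) : b = b 0 • idem k 2 0 + b 1 • (1 - idem k 2 0) := by
  ext i
  fin_cases i <;> simp [idem]

variable {V : Submodule k (RAlg k l)}

/-- The pair defines a representation of `A * B` that descends to the quotient, and every submodule
is stable under `α` and `e`. -/
theorem IsIrreduciblePair.mem_irrepDims {M : Type u} [AddCommGroup M] [Module k M]
    {α : Diag k l →ₐ[k] Module.End k M} {e : Module.End k M} (h : IsIrreduciblePair α e)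
    (hV : V ≤ Abar k l ⊔ Bbar k l) (hVA : ¬ V ≤ Abar k l)
    (hcomm : ∀ x ∈ interA V, Commute (α x) e) :
    Cardinal.toENat (Module.rank k M) ∈ irrepDims k (SubspaceAb V) := by
  obtain ⟨F, hF⟩ := SubspaceAb.exists_lift V (FreeProd.lift α (homOfIdempotent e h.idempotent))
    (commute_map_of_commute_interA hV hVA _ (by
      intro x hx
      rw [FreeProd.lift_inl, FreeProd.lift_inr, homOfIdempotent_idem]
      exact hcomm x hx))
  let : Module (SubspaceAb V) M := Module.compHom M F.toRingHom
  have hsmul : ∀ (s : SubspaceAb V) (m : M), s • m = F s m := fun _ _ => rfl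
  have : IsScalarTower k (SubspaceAb V) M := ⟨fun c s m => by simp [hsmul]⟩
  refine ⟨M, inferInstance, inferInstance, inferInstance, inferInstance, ?_, rfl⟩
  have := h.nontrivial
  have : Nontrivial (Submodule (SubspaceAb V) M) := (Submodule.nontrivial_iff _).2 inferInstance
  suffices IsSimpleOrder (Submodule (SubspaceAb V) M) from ⟨⟩
  refine ⟨fun U => ?_⟩
  have := h.eq_bot_or_eq_top (U.restrictScalars k) ?_ ?_
  · simpa using this
  · intro a u hu
    have := U.smul_mem (SubspaceAb.mk V (inA k l a)) hu
    rwa [hsmul, hF, FreeProd.lift_inl] at this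
  · intro u hu
    have := U.smul_mem (SubspaceAb.mk V (inB k l (idem k 2 0))) hu
    rwa [hsmul, hF, FreeProd.lift_inr, homOfIdempotent_idem] at this

theorem exists_isIrreduciblePair {M : Type u} [AddCommGroup M] [Module k M]
    [Module (SubspaceAb V) M] [IsScalarTower k (SubspaceAb V) M]
    [IsSimpleModule (SubspaceAb V) M]
    (hV : V ≤ Abar k l ⊔ Bbar k l) (hVA : ¬ V ≤ Abar k l) :
    ∃ (α : Diag k l →ₐ[k] Module.End k M) (e : Module.End k M), IsIrreduciblePair α e ∧
      ∀ x ∈ interA V, Commute (α x) e := by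
  let ρ : RAlg k l →ₐ[k] Module.End k M :=
    (Algebra.lsmul k k M).comp (SubspaceAb.mk V)
  have hρ : ∀ r m, ρ r m = SubspaceAb.mk V r • m := fun _ _ => rfl
  refine ⟨ρ.comp (inA k l), ρ (inB k l (idem k 2 0)), ⟨?_, ?_, ?_⟩, ?_⟩
  · exact IsSimpleModule.nontrivial (SubspaceAb V) M
  · rw [← map_mul, ← map_mul]
    congr 2
    ext i
    fin_cases i <;> simp [idem]
  · intro U hA he
    -- The stabilizer of `U` is a subalgebra; containing `A` and `q₁`, it is all of `R`, so `U` is a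
    -- submodule.
    let S : Subalgebra k (RAlg k l) :=
      { carrier := {r | ∀ u ∈ U, ρ r u ∈ U}
        mul_mem' := fun {a b} ha hb u hu => by
          rw [map_mul]; exact ha _ (hb u hu)
        add_mem' := fun {a b} ha hb u hu => by
          rw [map_add]; exact add_mem (ha u hu) (hb u hu)
        algebraMap_mem' := fun c u hu => by
          rw [AlgHom.commutes]; exact U.smul_mem c hu }
    have hS : S = ⊤ := by
      refine FreeProd.eq_top_of_mem S hA fun b => ?_
      rw [diag_two_eq b, map_add, map_smul, map_smul, map_sub, map_one]
      exact add_mem (S.smul_mem he _) (S.smul_mem (sub_mem (one_mem S) he) _)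
    let U' : Submodule (SubspaceAb V) M :=
      { U with
        smul_mem' := fun s u hu => by
          obtain ⟨r, rfl⟩ := PartialAb.mk_surjective _ s
          have : r ∈ S := by rw [hS]; trivial
          exact this u hu }
    have hU' : U'.restrictScalars k = U := rfl
    rcases eq_bot_or_eq_top U' with h | h
    · left; rw [← hU', h]; simp
    · right; rw [← hU', h]; simp
  · intro x hx
    exact (commute_mk_of_mem_interA hV hVA hx).map (Algebra.lsmul k k M)

end IrreduciblePairs

/-! ### Auxiliary facts on idempotents, `k[z]`-modules and ranks -/

theorem sum_idem {k : Type u} [Field k] {l : ℕ} : ∑ i, idem k l i = 1 := by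
  ext j
  simp [idem, Finset.sum_apply, Pi.single_apply]

theorem idem_mul {k : Type u} [Field k] {l : ℕ} (i : Fin l) (a : Diag k l) :
    idem k l i * a = a i • idem k l i := by
  ext j
  by_cases h : j = i
  · subst h; simp [idem]
  · simp [idem, h]

theorem self_mem_block {k : Type u} [Field k] {l : ℕ} (V₁ : Submodule k (Diag k l)) (i : Fin l) :
    i ∈ block V₁ i :=
  mem_block.2 fun _ _ => rfl

/-- An endomorphism `z` that turns a nonzero space into a finitely generated `k[z]`-module
has a scalar shift that is not surjective. -/
theorem exists_range_sub_algebraMap_ne_top {k : Type*} [Field k] [IsAlgClosed k] {M : Type*}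
    [AddCommGroup M] [Module k M] [Nontrivial M] (z : Module.End k M)
    [Module.Finite (Polynomial k) (Module.AEval' z)] :
    ∃ c : k, LinearMap.range (z - algebraMap k (Module.End k M) c) ≠ ⊤ := by
  have : Nontrivial (Module.AEval' z) := (Module.AEval'.of z).symm.toEquiv.nontrivial
  -- Finite generation provides a maximal submodule `N`. The annihilator of the simple quotient is a
  -- maximal ideal of `k[X]`, hence generated by some `X - c`, so the image of `z - c` lies in `N`.
  obtain ⟨N, hN, -⟩ := (eq_top_or_exists_le_coatom
    (⊥ : Submodule (Polynomial k) (Module.AEval' z))).resolve_left bot_ne_top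
  have hsimple := isSimpleModule_iff_isCoatom.2 hN
  have hmax := IsSimpleModule.annihilator_isMaximal (R := Polynomial k)
    (M := Module.AEval' z ⧸ N)
  set I := Module.annihilator (Polynomial k) (Module.AEval' z ⧸ N)
  obtain ⟨f, hf⟩ := (IsPrincipalIdealRing.principal I).principal
  have hf0 : f ≠ 0 := by
    rintro rfl
    rw [Submodule.span_zero_singleton] at hf
    exact (Ideal.bot_lt_of_maximal I (Polynomial.not_isField k)).ne' hf
  have hfu : ¬ IsUnit f := fun hu =>
    hmax.ne_top (by rw [hf]; exact Ideal.span_singleton_eq_top.2 hu)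
  obtain ⟨c, hc⟩ := IsAlgClosed.exists_root f (fun h => hfu
    (Polynomial.isUnit_iff_degree_eq_zero.2 h))
  have hI : I = Ideal.span {Polynomial.X - Polynomial.C c} := by
    refine hmax.eq_of_le ?_ ?_
    · exact fun h => Polynomial.not_isUnit_X_sub_C c (Ideal.span_singleton_eq_top.1 h)
    · rw [hf]
      exact Ideal.span_singleton_le_span_singleton.2 (Polynomial.dvd_iff_isRoot.2 hc)
  refine ⟨c, fun htop => hN.1 (eq_top_iff.2 fun x _ => ?_)⟩
  obtain ⟨m, rfl⟩ := (Module.AEval'.of z).surjective x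
  obtain ⟨n, rfl⟩ := LinearMap.range_eq_top.1 htop m
  have hmem : Polynomial.X - Polynomial.C c ∈ I := by
    rw [hI]; exact Ideal.mem_span_singleton_self _
  have h0 := Module.mem_annihilator.1 hmem (Submodule.Quotient.mk (Module.AEval'.of z n))
  rw [← Submodule.Quotient.mk_smul, Submodule.Quotient.mk_eq_zero] at h0
  have : (Polynomial.X - Polynomial.C c) • Module.AEval'.of z n =
      Module.AEval'.of z ((z - algebraMap k (Module.End k M) c) n) := by
    rw [sub_smul, Module.AEval'.X_smul_of, Module.AEval'.of, Module.AEval.C_smul]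
    simp
  rwa [this] at h0

theorem toENat_rank_le_of_span_eq_top {k : Type*} [Field k] {M : Type*} [AddCommGroup M]
    [Module k M] (s : Finset M) (hs : Submodule.span k (s : Set M) = ⊤) :
    Cardinal.toENat (Module.rank k M) ≤ s.card := by
  have h := rank_span_finset_le (R := k) s
  rw [hs, rank_top] at h
  simpa using Cardinal.toENat.monotone' h

/-! ### Upper bounds for the dimension of an irreducible pair -/

section Bounds

variable {k : Type u} [Field k] {l : ℕ} {M : Type*} [AddCommGroup M] [Module k M]
  {α : Diag k l →ₐ[k] Module.End k M} {e : Module.End k M} {V : Submodule k (RAlg k l)}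

/-- In an irreducible pair only the primitive idempotents of one block act nontrivially. -/
theorem IsIrreduciblePair.exists_block (h : IsIrreduciblePair α e)
    (hcomm : ∀ x ∈ interA V, Commute (α x) e) :
    ∃ i, α (∑ j ∈ block (interA V) i, idem k l j) = 1 := by
  classical
  have := h.nontrivial
  have hi : ∃ i, α (idem k l i) ≠ 0 := by
    by_contra! h0
    have h1 : (1 : Module.End k M) = 0 := by
      rw [← map_one α, ← sum_idem, map_sum]
      exact Finset.sum_eq_zero fun i _ => h0 i
    exact one_ne_zero h1
  obtain ⟨i, hi⟩ := hi
  refine ⟨i, ?_⟩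
  set P := ∑ j ∈ block (interA V) i, idem k l j with hP
  have hPi : P i = 1 := by
    simp [hP, idem, Finset.sum_apply, Pi.single_apply, self_mem_block]
  have hPP : P * P = P := by
    ext m
    simp [hP, idem, Finset.sum_apply, Pi.single_apply]
  have hPe : Commute (α P) e := commute_of_mem_AOf α hcomm (block_idem_mem_AOf i)
  -- `α P` commutes with `α(A)` and with `e`, so its range is invariant. It is nonzero because `P *
  -- p_i = p_i` acts nontrivially.
  have hrange := h.eq_bot_or_eq_top (LinearMap.range (α P)) ?_ ?_
  rcases hrange with h' | h'
  · rw [LinearMap.range_eq_bot] at h'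
    refine absurd ?_ hi
    rw [← one_smul k (idem k l i), ← hPi, ← idem_mul, map_mul, h', mul_zero]
  · ext m
    obtain ⟨n, rfl⟩ := LinearMap.range_eq_top.1 h' m
    rw [← Module.End.mul_apply, ← map_mul, hPP]
    rfl
  · rintro a _ ⟨u, rfl⟩
    exact ⟨α a u, by
      rw [← Module.End.mul_apply, ← Module.End.mul_apply, ← map_mul, ← map_mul, mul_comm]⟩
  · rintro _ ⟨u, rfl⟩
    exact ⟨e u, by rw [← Module.End.mul_apply, ← Module.End.mul_apply, hPe.eq]⟩

/-- No finiteness of `M` is needed: if `p ≠ 0`, any nonzero vector of its image is fixed. -/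
theorem exists_eigenvector_of_idempotent [Nontrivial M] {p : Module.End k M} (hp : p * p = p) :
    ∃ m : M, m ≠ 0 ∧ ∃ c : k, p m = c • m := by
  by_cases h : p = 0
  · obtain ⟨m, hm⟩ := exists_ne (0 : M)
    exact ⟨m, hm, 0, by simp [h]⟩
  · obtain ⟨m, hm⟩ : ∃ m, p m ≠ 0 := by
      by_contra! h'
      exact h (LinearMap.ext h')
    exact ⟨p m, hm, 1, by rw [← Module.End.mul_apply, hp, one_smul]⟩

/-- Here `A` acts by scalars, so the line through an eigenvector of `e` is invariant. -/
theorem IsIrreduciblePair.rank_le_one (h : IsIrreduciblePair α e) {i : Fin l}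
    (hi : α (idem k l i) = 1) : Cardinal.toENat (Module.rank k M) ≤ 1 := by
  classical
  have := h.nontrivial
  obtain ⟨m, hm, c, hc⟩ := exists_eigenvector_of_idempotent h.idempotent
  have hα : ∀ a, α a = a i • 1 := by
    intro a
    rw [← one_mul (α a), ← hi, ← map_mul, idem_mul, map_smul]
  have htop := (h.eq_bot_or_eq_top (Submodule.span k {m}) ?_ ?_).resolve_left
    (by simpa using hm)
  · simpa using toENat_rank_le_of_span_eq_top {m} (by simpa using htop)
  · intro a u hu
    rw [hα]
    exact Submodule.smul_mem _ _ hu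
  · intro u hu
    obtain ⟨d, rfl⟩ := Submodule.mem_span_singleton.1 hu
    rw [map_smul, hc]
    exact Submodule.smul_mem _ _ (Submodule.smul_mem _ _ (Submodule.mem_span_singleton_self m))

/-- Two idempotents `p`, `q` commute with `(p - q)²`. -/
theorem commute_sub_sq_of_idempotent {T : Type*} [Ring T] {p q : T} (hp : p * p = p)
    (hq : q * q = q) : Commute ((p - q) * (p - q)) p := by
  have h1 : (p - q) * (p - q) = p + q - p * q - q * p := by
    rw [mul_sub, sub_mul, sub_mul, hp, hq]; abel
  have h2 : p * (q * p) = p * q * p := (mul_assoc _ _ _).symm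
  have h3 : q * p * p = q * p := by rw [mul_assoc, hp]
  have h4 : p * (p * q) = p * q := by rw [← mul_assoc, hp]
  rw [h1]
  change _ * _ = _ * _
  rw [sub_mul, sub_mul, add_mul, mul_sub, mul_sub, mul_add, hp, h2, h3, h4]
  abel

/-- An irreducible pair in which `k^{⊕ l}` acts through one idempotent has dimension at most
two. -/
theorem IsIrreduciblePair.rank_le_two [IsAlgClosed k] (h : IsIrreduciblePair α e)
    {p : Module.End k M} (hp : p * p = p) (hα : ∀ a, ∃ c d : k, α a = c • p + d • 1) :
    Cardinal.toENat (Module.rank k M) ≤ 2 := by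
  classical
  have := h.nontrivial
  have he := h.idempotent
  have hirr : ∀ U : Submodule k M, (∀ u ∈ U, p u ∈ U) → (∀ u ∈ U, e u ∈ U) →
      U = ⊥ ∨ U = ⊤ := by
    intro U hU heU
    refine h.eq_bot_or_eq_top U (fun a u hu => ?_) heU
    obtain ⟨c, d, hcd⟩ := hα a
    rw [hcd]
    exact add_mem (U.smul_mem c (hU u hu)) (U.smul_mem d hu)
  obtain ⟨m, hm, ε, hε⟩ := exists_eigenvector_of_idempotent hp
  set z := (p - e) * (p - e) with hz
  have hzp : Commute z p := commute_sub_sq_of_idempotent hp he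
  have hze : Commute z e := by
    have := commute_sub_sq_of_idempotent he hp
    rwa [← neg_sub p e, neg_mul_neg] at this
  -- Expanding `z` rewrites `p e` through `e p`; with `p m = ε m`, this puts `p (e m)` in the span
  -- of `m`, `e m` and `z m`.
  have hpe : ∀ u, p (e u) = p u + e u - e (p u) - z u := by
    intro u
    have : p * e = p + e - e * p - z := by
      rw [hz, mul_sub, sub_mul, sub_mul, hp, he]; abel
    exact LinearMap.congr_fun this u
  have hee : ∀ u, e (e u) = e u := fun u => LinearMap.congr_fun he u
  have hzp' : ∀ u, z (p u) = p (z u) := fun u => LinearMap.congr_fun hzp u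
  have hze' : ∀ u, z (e u) = e (z u) := fun u => LinearMap.congr_fun hze u
  -- `M` might a priori be infinite-dimensional, so `z` need not obviously have an eigenvalue. But
  -- the `k[z]`-span of `m` and `e m` is invariant, hence `M` is finitely generated over `k[z]`.
  have hfin : Module.Finite (Polynomial k) (Module.AEval' z) := by
    let N : Submodule (Polynomial k) (Module.AEval' z) :=
      Submodule.span _ {Module.AEval'.of z m, Module.AEval'.of z (e m)}
    let U : Submodule k M :=
      (N.restrictScalars k).comap (Module.AEval'.of z).toLinearMap
    have hU : ∀ u, u ∈ U ↔ Module.AEval'.of z u ∈ N := fun _ => Iff.rfl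
    have haeval : ∀ (f : Polynomial k), ∀ u ∈ U, Polynomial.aeval z f u ∈ U :=
      fun f u hu => N.smul_mem f ((hU u).1 hu)
    have hpoly : ∀ (w : Module.End k M), Commute z w →
        (∀ u ∈ ({m, e m} : Set M), w u ∈ U) → ∀ u ∈ U, w u ∈ U := by
      intro w hw hwU u hu
      obtain ⟨f, g, hfg⟩ := Submodule.mem_span_pair.1 ((hU u).1 hu)
      have hu' : Polynomial.aeval z f m + Polynomial.aeval z g (e m) = u :=
        (Module.AEval'.of z).injective hfg
      have hwa : ∀ (f : Polynomial k) v, w (Polynomial.aeval z f v) =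
          Polynomial.aeval z f (w v) := fun f v =>
        LinearMap.congr_fun (Algebra.commute_of_mem_adjoin_singleton_of_commute
          (Polynomial.aeval_mem_adjoin_singleton k z) hw.symm) v
      rw [← hu', map_add, hwa, hwa]
      exact add_mem (haeval f _ (hwU _ (by simp))) (haeval g _ (hwU _ (by simp)))
    have hmU : m ∈ U := (hU m).2 (Submodule.subset_span (by simp))
    have hemU : e m ∈ U := (hU _).2 (Submodule.subset_span (by simp))
    have hzU : ∀ u ∈ U, z u ∈ U := fun u hu => by
      simpa using haeval Polynomial.X u hu
    have htop := (hirr U (hpoly p hzp ?_) (hpoly e hze ?_)).resolve_left ?_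
    · refine ⟨⟨{Module.AEval'.of z m, Module.AEval'.of z (e m)}, ?_⟩⟩
      rw [eq_top_iff]
      intro x _
      obtain ⟨u, rfl⟩ := (Module.AEval'.of z).surjective x
      have : u ∈ U := by rw [htop]; trivial
      simpa [hU] using this
    · rintro u (rfl | rfl)
      · rw [hε]; exact U.smul_mem _ hmU
      · rw [hpe, hε, map_smul]
        exact sub_mem (sub_mem (add_mem (U.smul_mem _ hmU) hemU) (U.smul_mem _ hemU))
          (hzU _ hmU)
    · rintro u (rfl | rfl)
      · exact hemU
      · rw [hee]; exact hemU
    · exact fun h0 => hm (by simpa [h0] using hmU)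
  obtain ⟨c, hc⟩ := exists_range_sub_algebraMap_ne_top z
  -- Schur's argument: the range of `z - c` is invariant and proper, hence zero.
  have hzc : ∀ u, z u = c • u := by
    have h0 := (hirr (LinearMap.range (z - algebraMap k (Module.End k M) c)) ?_ ?_).resolve_right
      hc
    · intro u
      have := LinearMap.congr_fun (LinearMap.range_eq_bot.1 h0) u
      simpa [sub_eq_zero] using this
    · rintro _ ⟨u, rfl⟩
      exact ⟨p u, by simp [hzp']⟩
    · rintro _ ⟨u, rfl⟩
      exact ⟨e u, by simp [hze']⟩
  have hmem : m ∈ Submodule.span k {m, e m} := Submodule.subset_span (by simp)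
  have heem : e m ∈ Submodule.span k {m, e m} := Submodule.subset_span (by simp)
  -- With `z` scalar, the `k`-span of `m` and `e m` is already invariant.
  have htop := (hirr (Submodule.span k {m, e m}) ?_ ?_).resolve_left ?_
  · refine (toENat_rank_le_of_span_eq_top {m, e m} (by simpa using htop)).trans ?_
    exact_mod_cast Finset.card_le_two
  · intro u hu
    obtain ⟨a, b, rfl⟩ := Submodule.mem_span_pair.1 hu
    rw [map_add, map_smul, map_smul, hpe, hε, map_smul, hzc]
    refine add_mem (Submodule.smul_mem _ _ (Submodule.smul_mem _ _ hmem))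
      (Submodule.smul_mem _ _ (sub_mem (sub_mem (add_mem (Submodule.smul_mem _ _ hmem) heem)
        (Submodule.smul_mem _ _ heem)) (Submodule.smul_mem _ _ hmem)))
  · intro u hu
    obtain ⟨a, b, rfl⟩ := Submodule.mem_span_pair.1 hu
    rw [map_add, map_smul, map_smul, hee]
    exact add_mem (Submodule.smul_mem _ _ heem) (Submodule.smul_mem _ _ heem)
  · intro h0
    exact hm (by simpa [h0] using hmem)

end Bounds

/-! ### Explicit irreducible pairs on function spaces -/

section Constructions

variable {k : Type u} [Field k] {l : ℕ} {X : Type}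

/-- The representation of `k^{⊕ l}` on the functions on `X` by multiplication after pull-back
along `g : X → {1, …, l}`. -/
def pullbackRep (k : Type u) [Field k] {l : ℕ} {X : Type} (g : X → Fin l) :
    Diag k l →ₐ[k] Module.End k (X → k) :=
  (Algebra.lmul k (X → k)).comp (AlgHom.pi fun x => Pi.evalAlgHom k _ (g x))

theorem pullbackRep_apply (g : X → Fin l) (a : Diag k l) (m : X → k) (x : X) :
    pullbackRep k g a m x = a (g x) * m x := rfl

/-- Elements of `V₁` are constant on the block that contains the image of `g`, so they act by
scalars. -/
theorem commute_pullbackRep {V₁ : Submodule k (Diag k l)} (i : Fin l) {g : X → Fin l}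
    (hg : ∀ x, g x ∈ block V₁ i) {a : Diag k l} (ha : a ∈ V₁) (e : Module.End k (X → k)) :
    Commute (pullbackRep k g a) e := by
  have : pullbackRep k g a = algebraMap k _ (a i) := by
    refine LinearMap.ext fun m => funext fun x => ?_
    rw [pullbackRep_apply, ← mem_block.1 (hg x) a ha]
    rfl
  rw [this]
  exact Algebra.commutes _ _

/-- A subspace of functions that is closed under multiplication by a function with pairwise
distinct values contains the delta function of every point of its support. -/
theorem single_mem_of_mul_mem {n : ℕ} {U : Submodule k (Fin n → k)} {d : Fin n → k}
    (hd : Function.Injective d) (hU : ∀ u ∈ U, d * u ∈ U) {u : Fin n → k} (hu : u ∈ U)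
    {i : Fin n} (hi : u i ≠ 0) : Pi.single i 1 ∈ U := by
  let S : Subalgebra k (Fin n → k) :=
    { carrier := {a | ∀ u ∈ U, a * u ∈ U}
      mul_mem' := fun {a b} ha hb u hu => by rw [mul_assoc]; exact ha _ (hb u hu)
      add_mem' := fun {a b} ha hb u hu => by rw [add_mul]; exact add_mem (ha u hu) (hb u hu)
      algebraMap_mem' := fun c u hu => by
        rw [← Algebra.smul_def]; exact U.smul_mem c hu }
  have hS : Algebra.adjoin k (Submodule.span k {d} : Set (Diag k n)) ≤ S := by
    refine Algebra.adjoin_le fun x hx => ?_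
    obtain ⟨c, rfl⟩ := Submodule.mem_span_singleton.1 hx
    exact S.smul_mem hU c
  -- Distinct values make the blocks of `k d` singletons, so `adjoin_eq_span_block` puts the
  -- primitive idempotents into the algebra generated by `d`.
  have hblock : block (Submodule.span k {d}) i = {i} := by
    ext j
    rw [mem_block, Finset.mem_singleton]
    refine ⟨fun h => (hd (h d (Submodule.mem_span_singleton_self d))).symm, ?_⟩
    rintro rfl x _
    rfl
  have hmem : idem k n i ∈ Subalgebra.toSubmodule
      (Algebra.adjoin k (Submodule.span k {d} : Set (Diag k n))) := by
    rw [adjoin_eq_span_block]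
    exact Submodule.subset_span ⟨i, by simp [hblock]⟩
  have := U.smul_mem (u i)⁻¹ (hS hmem u hu)
  rwa [idem_mul, smul_smul, inv_mul_cancel₀ hi, one_smul] at this

theorem eq_top_of_forall_single_mem {n : ℕ} {U : Submodule k (Fin n → k)}
    (h : ∀ i, Pi.single i 1 ∈ U) : U = ⊤ := by
  refine eq_top_iff.2 fun u _ => ?_
  rw [pi_eq_sum_univ' u]
  exact Submodule.sum_mem _ fun i _ => U.smul_mem _ (h i)

theorem isIrreduciblePair_one (i : Fin l) :
    IsIrreduciblePair (pullbackRep k (fun _ : Fin 1 => i)) 0 where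
  nontrivial := inferInstance
  idempotent := by simp
  eq_bot_or_eq_top U _ _ := by
    refine or_iff_not_imp_left.2 fun hU => ?_
    obtain ⟨u, hu, hu0⟩ := (Submodule.ne_bot_iff U).1 hU
    obtain ⟨j, hj⟩ := Function.ne_iff.1 hu0
    -- On a single point even the zero function has pairwise distinct values.
    have := single_mem_of_mul_mem (U := U) (d := 0) (Function.injective_of_subsingleton _)
      (by simp) hu hj
    exact eq_top_of_forall_single_mem fun j' => Subsingleton.elim j j' ▸ this

/-- The averaging operator on the functions on two points. -/
def average (k : Type u) [Field k] : Module.End k (Fin 2 → k) :=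
  LinearMap.pi fun _ => (2 : k)⁻¹ • LinearMap.proj 0 + (2 : k)⁻¹ • LinearMap.proj 1

theorem average_apply (m : Fin 2 → k) (x : Fin 2) :
    average k m x = 2⁻¹ * m 0 + 2⁻¹ * m 1 := rfl

/-- A nonzero invariant subspace contains a delta function; its average is nonzero at both points,
which yields the other delta function. -/
theorem isIrreduciblePair_two [CharZero k] {g : Fin 2 → Fin l} (hg : Function.Injective g) :
    IsIrreduciblePair (pullbackRep k g) (average k) where
  nontrivial := inferInstance
  idempotent := by
    refine LinearMap.ext fun m => funext fun x => ?_
    simp only [Module.End.mul_apply, average_apply]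
    ring
  eq_bot_or_eq_top U hU he := by
    refine or_iff_not_imp_left.2 fun hU0 => ?_
    obtain ⟨u, hu, hu0⟩ := (Submodule.ne_bot_iff U).1 hU0
    obtain ⟨j, hj⟩ := Function.ne_iff.1 hu0
    have hd : Function.Injective fun x => ((g x : ℕ) : k) :=
      Nat.cast_injective.comp (Fin.val_injective.comp hg)
    have hmul : ∀ u ∈ U, (fun x => ((g x : ℕ) : k)) * u ∈ U := fun u hu =>
      hU (fun y => ((y : ℕ) : k)) u hu
    have h1 := single_mem_of_mul_mem hd hmul hu hj
    refine eq_top_of_forall_single_mem fun i => single_mem_of_mul_mem hd hmul (he _ h1) ?_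
    rw [average_apply]
    fin_cases j <;> simp

/-- An idempotent operator on three copies of the functions on a cyclically ordered set. Its image
is the diagonal, and its three components on the diagonal are the multiplication by `t + 1`, the
cyclic shift, and what remains of the identity. -/
def cyclicProj (k : Type u) [Field k] (n : ℕ) : Module.End k (Fin 3 × Fin (n + 1) → k) :=
  LinearMap.pi fun x =>
    ((x.2 : ℕ) + 1 : k) • LinearMap.proj (0, x.2) + LinearMap.proj (1, x.2 + 1)
      - ((x.2 : ℕ) : k) • LinearMap.proj (2, x.2) - LinearMap.proj (2, x.2 + 1)

theorem cyclicProj_apply (n : ℕ) (m : Fin 3 × Fin (n + 1) → k) (x : Fin 3 × Fin (n + 1)) :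
    cyclicProj k n m x = ((x.2 : ℕ) + 1 : k) * m (0, x.2) + m (1, x.2 + 1)
      - ((x.2 : ℕ) : k) * m (2, x.2) - m (2, x.2 + 1) := rfl

/-- For invariant `U`, let `W` be the space of functions whose diagonal copy lies in `U`. Isolating
one of the three copies and applying the projection maps each component of `U` into `W`, so `W` is
stable under multiplication by `t + 1` and under the cyclic shift. Hence `W` is zero or everything,
and then so is `U`. -/
theorem isIrreduciblePair_cyclic [CharZero k] (n : ℕ) {g : Fin 3 → Fin l}
    (hg : Function.Injective g) :
    IsIrreduciblePair (pullbackRep k fun x : Fin 3 × Fin (n + 1) => g x.1)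
      (cyclicProj k n) where
  nontrivial := inferInstance
  idempotent := by
    refine LinearMap.ext fun m => funext fun x => ?_
    simp only [Module.End.mul_apply, cyclicProj_apply]
    ring
  eq_bot_or_eq_top U hU he := by
    let D : (Fin (n + 1) → k) →ₗ[k] (Fin 3 × Fin (n + 1) → k) := LinearMap.funLeft k k Prod.snd
    let W := U.comap D
    have hmask : ∀ u ∈ U, ∀ s : Fin 3, (fun x => if x.1 = s then u x else 0) ∈ U := by
      intro u hu s
      convert hU (idem k l (g s)) u hu using 1
      funext x
      rw [pullbackRep_apply]
      by_cases h : x.1 = s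
      · simp [idem, h]
      · simp [idem, h, hg.ne h]
    have hmemW : ∀ w, w ∈ W ↔ D w ∈ U := fun _ => Iff.rfl
    have hcomp : ∀ u ∈ U,
        (fun t : Fin (n + 1) => ((t : ℕ) + 1 : k) * u (0, t)) ∈ W ∧
        (fun t : Fin (n + 1) => u (1, t + 1)) ∈ W ∧
        (fun t : Fin (n + 1) => - (((t : ℕ) : k) * u (2, t)) - u (2, t + 1)) ∈ W := by
      intro u hu
      refine ⟨?_, ?_, ?_⟩
      · rw [hmemW]
        convert he _ (hmask u hu 0) using 1
        funext x
        simp [cyclicProj_apply, D, LinearMap.funLeft_apply]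
      · rw [hmemW]
        convert he _ (hmask u hu 1) using 1
        funext x
        simp [cyclicProj_apply, D, LinearMap.funLeft_apply]
      · rw [hmemW]
        convert he _ (hmask u hu 2) using 1
        funext x
        simp [cyclicProj_apply, D, LinearMap.funLeft_apply]
    by_cases hW : W = ⊥
    · left
      refine (Submodule.eq_bot_iff U).2 fun u hu => ?_
      obtain ⟨h0, h1, h2⟩ := hcomp u hu
      rw [hW, Submodule.mem_bot] at h0 h1 h2
      have h2' : ∀ t : Fin (n + 1), u (2, t + 1) = - (((t : ℕ) : k) * u (2, t)) := fun t =>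
        (sub_eq_zero.1 (congrFun h2 t)).symm
      -- The factor `t` vanishes at `t = 0`, which starts the recursion; the zeros then propagate
      -- around the cycle.
      have h2'' : ∀ t : Fin (n + 1), u (2, t + 1) = 0 := by
        intro t
        induction t using Fin.induction with
        | zero => rw [h2']; simp
        | succ t ih =>
          rw [h2', ← Fin.coeSucc_eq_succ, ih]; simp
      funext ⟨s, t⟩
      fin_cases s
      · have := congrFun h0 t
        simpa [Nat.cast_add_one_ne_zero] using this
      · simpa using congrFun h1 (t - 1)
      · simpa using h2'' (t - 1)
    · right
      obtain ⟨w, hw, hw0⟩ := (Submodule.ne_bot_iff W).1 hW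
      obtain ⟨j, hj⟩ := Function.ne_iff.1 hw0
      have hd : Function.Injective fun t : Fin (n + 1) => ((t : ℕ) + 1 : k) := by
        intro a b h
        simpa [Fin.ext_iff] using h
      have hsingle : ∀ i, ∀ w ∈ W, w i ≠ 0 → Pi.single i 1 ∈ W := fun i w hw hi =>
        single_mem_of_mul_mem hd (fun w hw => (hcomp _ hw).1) hw hi
      have hshift : ∀ w ∈ W, (fun t => w (t + 1)) ∈ W := fun w hw => (hcomp _ hw).2.1
      -- The shift lowers the index: descend from any index to `0`, wrap around to the last one, and
      -- descend through all of them.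
      have hstep : ∀ i, Pi.single (i + 1) 1 ∈ W → Pi.single i 1 ∈ W := fun i hi =>
        hsingle i _ (hshift _ hi) (by simp)
      have hzero : ∀ i, Pi.single i 1 ∈ W → Pi.single 0 1 ∈ W := by
        intro i
        induction i using Fin.induction with
        | zero => exact id
        | succ i ih => exact fun hi => ih (hstep _ (by rwa [Fin.coeSucc_eq_succ]))
      have hWtop : W = ⊤ := eq_top_of_forall_single_mem fun i => by
        induction i using Fin.reverseInduction with
        | last =>
          refine hstep _ ?_
          rw [Fin.last_add_one]
          exact hzero j (hsingle j w hw hj)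
        | cast i ih => exact hstep _ (by rwa [Fin.coeSucc_eq_succ])
      refine eq_top_iff.2 fun u _ => ?_
      have hu : u = ∑ s : Fin 3, fun x => if x.1 = s then D (fun t => u (s, t)) x else 0 := by
        funext x
        simp [Finset.sum_apply, D, LinearMap.funLeft_apply]
      rw [hu]
      refine Submodule.sum_mem _ fun s _ => hmask _ ?_ s
      have : (fun t => u (s, t)) ∈ W := by rw [hWtop]; trivial
      exact this

end Constructions

/-! ### The four cases -/

section Main

variable {k : Type u} [Field k] {l : ℕ} {V : Submodule k (RAlg k l)}

/-- `V` lies in the image of the commutative algebra `A`, so the identity of `R` factors through the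
quotient. -/
theorem bijective_mk_of_le_Abar (hVA : V ≤ Abar k l) :
    Function.Bijective (SubspaceAb.mk V) := by
  obtain ⟨F, hF⟩ := SubspaceAb.exists_lift V (AlgHom.id k _) (by
    intro x hx y hy
    obtain ⟨a, -, rfl⟩ := hVA hx
    obtain ⟨b, -, rfl⟩ := hVA hy
    exact (Commute.all a b).map (inA k l))
  exact ⟨Function.LeftInverse.injective hF, PartialAb.mk_surjective _⟩

open TensorProduct in
/-- If `A(V) = A`, then `(V, R)^{ab}` is `A ⊗ B`. -/
theorem exists_algEquiv_tensorProduct (hV : V ≤ Abar k l ⊔ Bbar k l) (hVA : ¬ V ≤ Abar k l)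
    (htop : AOf V = ⊤) :
    ∃ e : SubspaceAb V ≃ₐ[k] Diag k l ⊗[k] Diag k 2,
      (∀ a, e (SubspaceAb.mk V (inA k l a)) = a ⊗ₜ[k] 1) ∧
      (∀ b, e (SubspaceAb.mk V (inB k l b)) = 1 ⊗ₜ[k] b) := by
  obtain ⟨F, hF⟩ := SubspaceAb.exists_lift V
    (FreeProd.lift (Algebra.TensorProduct.includeLeft : Diag k l →ₐ[k] Diag k l ⊗[k] Diag k 2)
      Algebra.TensorProduct.includeRight) (fun _ _ _ _ => Commute.all _ _)
  have hFA : ∀ a, F (SubspaceAb.mk V (inA k l a)) = a ⊗ₜ[k] 1 := fun a => by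
    rw [hF, FreeProd.lift_inl]; rfl
  have hFB : ∀ b, F (SubspaceAb.mk V (inB k l b)) = 1 ⊗ₜ[k] b := fun b => by
    rw [hF, FreeProd.lift_inr]; rfl
  let G : Diag k l ⊗[k] Diag k 2 →ₐ[k] SubspaceAb V :=
    Algebra.TensorProduct.lift ((SubspaceAb.mk V).comp (inA k l))
      ((SubspaceAb.mk V).comp (inB k l)) (by
        intro a b
        -- Since `A(V) = A`, all of `A` commutes with `q₁`, and `B` is spanned by `q₁` and `1 - q₁`.
        have h := commute_of_mem_AOf ((SubspaceAb.mk V).comp (inA k l))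
          (fun x hx => commute_mk_of_mem_interA hV hVA hx) (x := a) (by rw [htop]; trivial)
        rw [diag_two_eq b]
        simp only [map_add, map_smul, map_sub, map_one]
        exact (h.smul_right _).add_right (((Commute.one_right _).sub_right h).smul_right _))
  have hG : ∀ a b, G (a ⊗ₜ[k] b) =
      SubspaceAb.mk V (inA k l a) * SubspaceAb.mk V (inB k l b) := fun a b =>
    Algebra.TensorProduct.lift_tmul _ _ _ _ _
  have hFG : F.comp G = AlgHom.id k _ := by
    refine Algebra.TensorProduct.ext' fun a b => ?_
    rw [AlgHom.comp_apply, hG, map_mul, hFA, hFB, Algebra.TensorProduct.tmul_mul_tmul, one_mul,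
      mul_one, AlgHom.id_apply]
  have hGF : ∀ s, G (F s) = s := by
    intro s
    obtain ⟨r, rfl⟩ := PartialAb.mk_surjective _ s
    have : (G.comp F).comp (SubspaceAb.mk V) = SubspaceAb.mk V :=
      FreeProd.hom_ext
        (fun a => by
          rw [AlgHom.comp_apply, AlgHom.comp_apply, hFA, hG, map_one, map_one, mul_one])
        (fun b => by
          rw [AlgHom.comp_apply, AlgHom.comp_apply, hFB, hG, map_one, map_one, one_mul])
    exact DFunLike.congr_fun this r
  exact ⟨AlgEquiv.ofAlgHom F G hFG (AlgHom.ext hGF), hFA, hFB⟩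

/-- The functions on a finite set that is mapped into one block give an irreducible representation
of `(V, R)^{ab}` as soon as they form an irreducible pair. -/
theorem card_mem_irrepDims (hV : V ≤ Abar k l ⊔ Bbar k l) (hVA : ¬ V ≤ Abar k l)
    {X : Type} [Fintype X] {g : X → Fin l} (i : Fin l) (hg : ∀ x, g x ∈ block (interA V) i)
    {e : Module.End k (X → k)} (h : IsIrreduciblePair (pullbackRep k g) e) :
    (Fintype.card X : ℕ∞) ∈ irrepDims k (SubspaceAb V) := by
  have := h.mem_irrepDims hV hVA fun x hx => commute_pullbackRep i hg hx e
  simpa [rank_fun'] using this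

theorem mid_le (hV : V ≤ Abar k l ⊔ Bbar k l) (hVA : ¬ V ≤ Abar k l) {n : ℕ∞}
    (h : ∀ (M : Type u) [AddCommGroup M] [Module k M] (α : Diag k l →ₐ[k] Module.End k M)
      (e : Module.End k M), IsIrreduciblePair α e → (∀ x ∈ interA V, Commute (α x) e) →
      Cardinal.toENat (Module.rank k M) ≤ n) :
    mid k (SubspaceAb V) ≤ n := by
  refine sSup_le ?_
  rintro _ ⟨M, _, _, _, _, _, rfl⟩
  obtain ⟨α, e, hαe, hcomm⟩ := exists_isIrreduciblePair (M := M) hV hVA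
  exact h M α e hαe hcomm

/-- Coordinates that agree on `V ∩ Ā` agree on `A(V)`, whereas `p_i` separates `i` from every other
index. -/
theorem block_eq_singleton_of_AOf_eq_top (htop : AOf V = ⊤) (i : Fin l) :
    block (interA V) i = {i} := by
  ext j
  rw [Finset.mem_singleton]
  refine ⟨fun hj => ?_, fun h => h ▸ self_mem_block _ _⟩
  by_contra hne
  have hconst : ∀ x ∈ AOf V, x i = x j := by
    intro x hx
    induction hx using Algebra.adjoin_induction with
    | mem y hy => exact mem_block.1 hj y hy
    | algebraMap r => rfl
    | add a b _ _ ha hb => simp [ha, hb]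
    | mul a b _ _ ha hb => simp [ha, hb]
  have := hconst (idem k l i) (by rw [htop]; trivial)
  simp [idem, hne] at this

theorem mid_eq_one (hl : 1 ≤ l) (hV : V ≤ Abar k l ⊔ Bbar k l) (hVA : ¬ V ≤ Abar k l)
    (htop : AOf V = ⊤) : mid k (SubspaceAb V) = 1 := by
  refine le_antisymm (mid_le hV hVA fun M _ _ α e h hcomm => ?_) ?_
  · obtain ⟨i, hi⟩ := h.exists_block hcomm
    rw [block_eq_singleton_of_AOf_eq_top htop, Finset.sum_singleton] at hi
    exact h.rank_le_one hi
  · have := card_mem_irrepDims hV hVA ⟨0, hl⟩ (fun _ => self_mem_block _ _)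
      (isIrreduciblePair_one ⟨0, hl⟩)
    exact le_sSup (by simpa using this)

theorem card_block_le_maxBlock {V₁ : Submodule k (Diag k l)} (i : Fin l) :
    (block V₁ i).card ≤ maxBlock V₁ :=
  Finset.le_sup (f := fun i => (block V₁ i).card) (Finset.mem_univ i)

/-- If the largest block has at least `n + 1` elements, then `n + 1` distinct indices lie in one
block. -/
theorem exists_injective_of_lt_maxBlock {V₁ : Submodule k (Diag k l)} {n : ℕ}
    (h : n < maxBlock V₁) :
    ∃ (i : Fin l) (g : Fin (n + 1) → Fin l), Function.Injective g ∧ ∀ x, g x ∈ block V₁ i := by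
  obtain ⟨i, -, hi⟩ := Finset.lt_sup_iff.1 h
  obtain ⟨t, ht, hcard⟩ := Finset.exists_subset_card_eq (Nat.succ_le_of_lt hi)
  exact ⟨i, fun x => (t.equivFinOfCardEq hcard).symm x,
    Subtype.val_injective.comp (t.equivFinOfCardEq hcard).symm.injective,
    fun x => ht (Subtype.property _)⟩

theorem mid_eq_two [IsAlgClosed k] [CharZero k] (hV : V ≤ Abar k l ⊔ Bbar k l)
    (hVA : ¬ V ≤ Abar k l) (h2 : maxBlock (interA V) = 2) : mid k (SubspaceAb V) = 2 := by
  classical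
  refine le_antisymm (mid_le hV hVA fun M _ _ α e h hcomm => ?_) ?_
  · obtain ⟨i, hi⟩ := h.exists_block hcomm
    have hidem : idem k l i * idem k l i = idem k l i := by
      rw [idem_mul]; simp [idem]
    refine h.rank_le_two (p := α (idem k l i)) (by rw [← map_mul, hidem]) fun a => ?_
    have hcard : ((block (interA V) i).erase i).card ≤ 1 := by
      rw [Finset.card_erase_of_mem (self_mem_block _ _)]
      have := card_block_le_maxBlock (V₁ := interA V) i
      omega
    rw [← Finset.add_sum_erase _ _ (self_mem_block (interA V) i), map_add] at hi
    have : Nonempty (Fin l) := ⟨i⟩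
    -- The block that acts may still be a singleton; then `Q = 0` and `j` is arbitrary.
    obtain ⟨j, hj⟩ := Finset.card_le_one_iff_subset_singleton.1 hcard
    set Q := ∑ m ∈ (block (interA V) i).erase i, idem k l m
    have hQ : Q * a = a j • Q := by
      rw [Finset.sum_mul, Finset.smul_sum]
      refine Finset.sum_congr rfl fun m hm => ?_
      rw [idem_mul, Finset.mem_singleton.1 (hj hm)]
    have hQ' : α Q = 1 - α (idem k l i) := eq_sub_of_add_eq' hi
    -- With `p` the action of `p_i`, the element `a` acts as `a_i p + a_j (1 - p)`.
    refine ⟨a i - a j, a j, ?_⟩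
    rw [← one_mul (α a), ← hi, add_mul, ← map_mul, ← map_mul, hQ, idem_mul, map_smul, map_smul,
      hQ', sub_smul, smul_sub, smul_add]
    simp only [add_sub_cancel, smul_sub]
    abel
  · obtain ⟨i, g, hg, hgi⟩ := exists_injective_of_lt_maxBlock (V₁ := interA V) (n := 1) (by omega)
    have := card_mem_irrepDims hV hVA i hgi (isIrreduciblePair_two hg)
    exact le_sSup (by simpa using this)

theorem exists_large_mem_irrepDims [CharZero k] (hV : V ≤ Abar k l ⊔ Bbar k l)
    (hVA : ¬ V ≤ Abar k l) (h2 : 2 < maxBlock (interA V)) (n : ℕ) :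
    ∃ d : ℕ, n ≤ d ∧ (d : ℕ∞) ∈ irrepDims k (SubspaceAb V) := by
  obtain ⟨i, g, hg, hgi⟩ := exists_injective_of_lt_maxBlock h2
  have h := card_mem_irrepDims (X := Fin 3 × Fin (n + 1)) (g := fun x => g x.1) hV hVA i
    (fun x => hgi x.1) (isIrreduciblePair_cyclic n hg)
  rw [Fintype.card_prod, Fintype.card_fin, Fintype.card_fin] at h
  exact ⟨3 * (n + 1), by omega, h⟩

end Main

end PartialAbelianization

end

open PartialAbelianization TensorProduct in
theorem mainTheorem7 {k : Type u} [Field k] [IsAlgClosed k] [CharZero k] (l : ℕ) (hl : 1 ≤ l)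
    (V : Submodule k (RAlg k l)) (hV : V ≤ Abar k l ⊔ Bbar k l) :
    (V ≤ Abar k l → Function.Bijective (SubspaceAb.mk V)) ∧
    (¬ V ≤ Abar k l → AOf V = ⊤ →
      (∃ e : SubspaceAb V ≃ₐ[k] Diag k l ⊗[k] Diag k 2,
        (∀ a, e (SubspaceAb.mk V (inA k l a)) = a ⊗ₜ[k] 1) ∧
        (∀ b, e (SubspaceAb.mk V (inB k l b)) = 1 ⊗ₜ[k] b)) ∧
      mid k (SubspaceAb V) = 1) ∧
    (¬ V ≤ Abar k l → maxBlock (interA V) = 2 → mid k (SubspaceAb V) = 2) ∧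
    (¬ V ≤ Abar k l → 2 < maxBlock (interA V) →
      mid k (SubspaceAb V) = ⊤ ∧
      ∀ n : ℕ, ∃ d : ℕ, n ≤ d ∧ (d : ℕ∞) ∈ irrepDims k (SubspaceAb V)) := by
  refine ⟨bijective_mk_of_le_Abar,
    fun hVA htop => ⟨exists_algEquiv_tensorProduct hV hVA htop, mid_eq_one hl hV hVA htop⟩,
    mid_eq_two hV, fun hVA h2 => ⟨?_, exists_large_mem_irrepDims hV hVA h2⟩⟩
  refine ENat.eq_top_iff_forall_ge.2 fun n => ?_
  obtain ⟨d, hnd, hd⟩ := exists_large_mem_irrepDims hV hVA h2 n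
  exact le_trans (by exact_mod_cast hnd) (le_sSup hd)
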